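/- All Banach spaces are real. Let $(M,d)$ be a metric space with a designated origin $0\in M$. For a Banach space $Y$, let $\mathrm{Lip}(M,Y)$ denote the space of all Lipschitz functions $f\colon M\to Y$ with $f(0)=0$, with the norm $$\|f\|:=\sup\left\{\frac{\|f(x)-f(y)\|}{d(x,y)} : x,y\in M,\ x\neq y\right\}.$$ For a Banach space $X$, let the vector-valued Lipschitz-free space be $$\mathcal F(M,X):=\overline{\operatorname{span}}\{\delta_{m,x} : m\in M,\ x\in X\}\subseteq \mathrm{Lip}(M,X^*)^*,\qquad \delta_{m,x}(f):=f(m)(x),$$ where the closure is taken in the norm topology. A Banach space is said to have the Schur property if every weakly null sequence in it is norm null. **Proposition 3.4.** Assume that $M$ is uniformly discrete, that is, $\theta=\inf_{m_1\neq m_2} d(m_1,m_2)>0$, and that $X$ is a Banach space with the Schur property. Then $\mathcal F(M,X)$ has the Schur property. -/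

import Mathlib

open Filter Topology

noncomputable section

namespace VectorLipschitz

/-- A real normed space has the Schur property if every weakly null sequence is norm null. -/
def HasSchurProperty (E : Type*) [NormedAddCommGroup E] [NormedSpace ℝ E] : Prop :=
  ∀ u : ℕ → E, Tendsto (fun n => toWeakSpace ℝ E (u n)) atTop (𝓝 0) → Tendsto u atTop (𝓝 0)

section LipSpace

variable {M : Type*} [MetricSpace M] (o : M) (Y : Type*) [NormedAddCommGroup Y] [NormedSpace ℝ Y]

/-- The vector space of Lipschitz functions `M → Y` vanishing at the origin `o`. -/
def lipSubmodule : Submodule ℝ (M → Y) where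
  carrier := {f | f o = 0 ∧ ∃ K : NNReal, LipschitzWith K f}
  zero_mem' := ⟨rfl, 0, LipschitzWith.const 0⟩
  add_mem' := by
    rintro f g ⟨hf, K, hK⟩ ⟨hg, L, hL⟩
    exact ⟨by simp [hf, hg], K + L, hK.add hL⟩
  smul_mem' := by
    rintro c f ⟨hf, K, hK⟩
    refine ⟨by simp [hf], ‖c‖₊ * K, ?_⟩
    exact (lipschitzWith_smul c).comp hK

/-- The space `Lip(M, Y)` of Lipschitz functions `M → Y` vanishing at the origin `o`. This is a
type of its own so that it carries the Lipschitz norm, not the topology of pointwise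
convergence. -/
def Lip : Type _ := lipSubmodule o Y

namespace Lip

variable {o Y}

instance : FunLike (Lip o Y) M Y where
  coe f := f.1
  coe_injective _ _ h := Subtype.ext h

instance : AddCommGroup (Lip o Y) := inferInstanceAs (AddCommGroup (lipSubmodule o Y))

instance : Module ℝ (Lip o Y) := inferInstanceAs (Module ℝ (lipSubmodule o Y))

@[simp] theorem zero_apply (m : M) : (0 : Lip o Y) m = 0 := rfl

@[simp] theorem add_apply (f g : Lip o Y) (m : M) : (f + g) m = f m + g m := rfl

@[simp] theorem smul_apply (c : ℝ) (f : Lip o Y) (m : M) : (c • f) m = c • f m := rfl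

theorem map_origin (f : Lip o Y) : f o = 0 := f.2.1

theorem exists_lipschitzWith (f : Lip o Y) : ∃ K : NNReal, LipschitzWith K f := f.2.2

/-- The set of all slopes `‖f x - f y‖ / d(x, y)` with `x ≠ y`. -/
def slopes (f : Lip o Y) : Set ℝ := {r | ∃ x y : M, x ≠ y ∧ r = ‖f x - f y‖ / dist x y}

/-- The Lipschitz norm: the supremum of all slopes. If `M` is a single point, then `f = 0`, there
are no slopes, and the value is `0`. -/
instance : Norm (Lip o Y) := ⟨fun f => sSup f.slopes⟩

theorem norm_def (f : Lip o Y) : ‖f‖ = sSup f.slopes := rfl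

theorem bddAbove_slopes (f : Lip o Y) : BddAbove f.slopes := by
  obtain ⟨K, hK⟩ := f.exists_lipschitzWith
  refine ⟨K, ?_⟩
  rintro r ⟨x, y, hxy, rfl⟩
  rw [div_le_iff₀ (dist_pos.2 hxy), ← dist_eq_norm]
  exact hK.dist_le_mul x y

theorem norm_sub_le (f : Lip o Y) (x y : M) : ‖f x - f y‖ ≤ ‖f‖ * dist x y := by
  rcases eq_or_ne x y with rfl | hxy
  · simp
  · rw [← div_le_iff₀ (dist_pos.2 hxy)]
    exact le_csSup f.bddAbove_slopes ⟨x, y, hxy, rfl⟩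

theorem norm_apply_le (f : Lip o Y) (x : M) : ‖f x‖ ≤ ‖f‖ * dist x o := by
  simpa [f.map_origin] using f.norm_sub_le x o

theorem norm_le_of_forall (f : Lip o Y) {C : ℝ} (hC : 0 ≤ C)
    (h : ∀ x y, ‖f x - f y‖ ≤ C * dist x y) : ‖f‖ ≤ C := by
  refine Real.sSup_le ?_ hC
  rintro r ⟨x, y, hxy, rfl⟩
  rw [div_le_iff₀ (dist_pos.2 hxy)]
  exact h x y

theorem norm_nonneg' (f : Lip o Y) : 0 ≤ ‖f‖ := by
  refine Real.sSup_nonneg ?_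
  rintro r ⟨x, y, -, rfl⟩
  positivity

theorem norm_smul_le' (c : ℝ) (f : Lip o Y) : ‖c • f‖ ≤ ‖c‖ * ‖f‖ := by
  refine norm_le_of_forall _ (mul_nonneg (norm_nonneg c) f.norm_nonneg') fun x y => ?_
  rw [smul_apply, smul_apply, ← smul_sub, norm_smul, mul_assoc]
  exact mul_le_mul_of_nonneg_left (f.norm_sub_le x y) (norm_nonneg c)

theorem normedSpaceCore : NormedSpace.Core ℝ (Lip o Y) where
  norm_nonneg := norm_nonneg'
  norm_smul c f := by
    refine le_antisymm (norm_smul_le' c f) ?_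
    rcases eq_or_ne c 0 with rfl | hc
    · simpa using norm_nonneg' _
    · have h := norm_smul_le' c⁻¹ (c • f)
      rw [smul_smul, inv_mul_cancel₀ hc, one_smul, norm_inv] at h
      rwa [le_inv_mul_iff₀ (norm_pos_iff.2 hc)] at h
  norm_triangle f g := by
    refine norm_le_of_forall _ (add_nonneg f.norm_nonneg' g.norm_nonneg') fun x y => ?_
    rw [add_apply, add_apply, add_sub_add_comm, add_mul]
    exact (norm_add_le _ _).trans (add_le_add (f.norm_sub_le x y) (g.norm_sub_le x y))
  norm_eq_zero_iff f := by
    refine ⟨fun h => DFunLike.ext _ _ fun x => ?_, ?_⟩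
    · have := f.norm_apply_le x
      rw [h, zero_mul] at this
      simpa using this
    · rintro rfl
      exact le_antisymm (norm_le_of_forall _ le_rfl fun x y => by simp) (norm_nonneg' _)

instance : NormedAddCommGroup (Lip o Y) := NormedAddCommGroup.ofCore normedSpaceCore

instance : NormedSpace ℝ (Lip o Y) := NormedSpace.ofCore normedSpaceCore

end Lip

end LipSpace

section FreeSpace

variable {M : Type*} [MetricSpace M] (o : M) (X : Type*) [NormedAddCommGroup X] [NormedSpace ℝ X]

variable {X} in
/-- The evaluation functional `δ_{m,x}` on `Lip(M, X*)`, sending `f` to `f(m)(x)`. -/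
def delta (m : M) (x : X) : StrongDual ℝ (Lip o (StrongDual ℝ X)) :=
  LinearMap.mkContinuous
    { toFun := fun f => f m x
      map_add' := fun _ _ => rfl
      map_smul' := fun _ _ => rfl }
    (dist m o * ‖x‖) (fun f => by
      calc ‖f m x‖ ≤ ‖f m‖ * ‖x‖ := (f m).le_opNorm x
        _ ≤ (‖f‖ * dist m o) * ‖x‖ := by gcongr; exact f.norm_apply_le m
        _ = dist m o * ‖x‖ * ‖f‖ := by ring)

@[simp] theorem delta_apply (m : M) (x : X) (f : Lip o (StrongDual ℝ X)) :
    delta o m x f = f m x := rfl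

/-- The vector-valued Lipschitz-free space `F(M, X)`: the norm closure, in the dual of
`Lip(M, X*)`, of the linear span of the evaluation functionals `δ_{m,x}`. -/
def lipschitzFree : Submodule ℝ (StrongDual ℝ (Lip o (StrongDual ℝ X))) :=
  (Submodule.span ℝ {φ | ∃ (m : M) (x : X), φ = delta o m x}).topologicalClosure

end FreeSpace

end VectorLipschitz

end

namespace VectorLipschitz

/-! ### Cutting and gluing Lipschitz functions. -/

section LipConstructions

variable {M : Type*} [MetricSpace M] {o : M} {Y : Type*} [NormedAddCommGroup Y] [NormedSpace ℝ Y]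

/-! Up to a norm null error, a weakly null sequence in the free space consists of finite sums
`freeSum o (c n)`, and these tend to zero at every Lipschitz function. Testing on functions
supported at one point `m ≠ o` shows that `c n m` is weakly null in `X`, hence norm null by the
Schur property.

The rest is a gliding hump, run twice through `tendsto_norm_freeSum_of_exhaustion`. If the norms
stay above `ε` along a subsequence while the restrictions to each member of an exhaustion vanish in
the limit, a sparser subsequence has its essential parts in disjoint layers. Almost norming
functions, cut to these layers, glue to a single Lipschitz `g` on which the subsequence stays away
from zero, a contradiction. The first run treats bounded sets, exhausted by finite sets: there sharp
cutoffs are Lipschitz because distances are at least `θ`. The second treats the whole space,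
exhausted by balls of radius `2 ^ j`: there slow radial cutoffs have bounds independent of the
radius. -/

theorem Lip.sub_apply (f g : Lip o Y) (m : M) : (f - g) m = f m - g m := rfl

theorem Lip.exists_of_bound (F : M → Y) (h0 : F o = 0) {C : ℝ} (hC : 0 ≤ C)
    (h : ∀ x y, ‖F x - F y‖ ≤ C * dist x y) :
    ∃ f : Lip o Y, (∀ m, f m = F m) ∧ ‖f‖ ≤ C := by
  let f : Lip o Y := ⟨F, h0, C.toNNReal, LipschitzWith.of_dist_le_mul fun x y => by
    rw [dist_eq_norm, Real.coe_toNNReal _ hC]; exact h x y⟩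
  exact ⟨f, fun _ => rfl, f.norm_le_of_forall hC h⟩

/-- Lipschitz functions with uniformly bounded norms and pairwise disjoint supports glue to a
Lipschitz function. -/
theorem Lip.exists_glue {ι : Type*} (h : ι → Lip o Y) {C : ℝ} (hC : 0 ≤ C) (hh : ∀ k, ‖h k‖ ≤ C)
    (hdisj : ∀ k l m, h k m ≠ 0 → h l m ≠ 0 → k = l) :
    ∃ g : Lip o Y, ‖g‖ ≤ 2 * C ∧ (∀ k m, h k m ≠ 0 → g m = h k m) ∧
      ∀ m, (∀ k, h k m = 0) → g m = 0 := by
  classical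
  let G : M → Y := fun m => if hm : ∃ k, h k m ≠ 0 then h hm.choose m else 0
  have hG : ∀ k m, h k m ≠ 0 → G m = h k m := by
    intro k m hk
    have hm : ∃ k, h k m ≠ 0 := ⟨k, hk⟩
    have : hm.choose = k := hdisj _ _ _ hm.choose_spec hk
    simp only [G, dif_pos hm, this]
  have hG0 : ∀ m, (∀ k, h k m = 0) → G m = 0 := by
    intro m hm
    have : ¬ ∃ k, h k m ≠ 0 := by simpa using hm
    simp only [G, dif_neg this]
  have hle : ∀ k x y, ‖h k x - h k y‖ ≤ C * dist x y := fun k x y =>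
    ((h k).norm_sub_le x y).trans (mul_le_mul_of_nonneg_right (hh k) dist_nonneg)
  have hbound : ∀ x y, ‖G x - G y‖ ≤ 2 * C * dist x y := by
    intro x y
    have hpos : 0 ≤ C * dist x y := mul_nonneg hC dist_nonneg
    by_cases hx : ∃ k, h k x ≠ 0
    · obtain ⟨k, hk⟩ := hx
      by_cases hy : ∃ l, h l y ≠ 0
      · obtain ⟨l, hl⟩ := hy
        rw [hG k x hk, hG l y hl]
        by_cases hkl : k = l
        · subst hkl
          linarith [hle k x y]
        -- Each of the two functions vanishes at the other point, so both values are increments over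
        -- the pair `x`, `y`; this is the source of the factor two.
        · have h1 : h k y = 0 := by
            by_contra hne
            exact hkl (hdisj _ _ _ hne hl)
          have h2 : h l x = 0 := by
            by_contra hne
            exact hkl (hdisj _ _ _ hk hne)
          have e1 := hle k x y
          have e2 := hle l x y
          rw [h1, sub_zero] at e1
          rw [h2, zero_sub, norm_neg] at e2
          linarith [_root_.norm_sub_le (h k x) (h l y)]
      · push Not at hy
        rw [hG k x hk, hG0 y hy]
        have e1 := hle k x y
        rw [hy k] at e1
        linarith
    · push Not at hx
      rw [hG0 x hx]
      by_cases hy : ∃ l, h l y ≠ 0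
      · obtain ⟨l, hl⟩ := hy
        rw [hG l y hl]
        have e1 := hle l x y
        rw [hx l] at e1
        linarith
      · push Not at hy
        rw [hG0 y hy]
        simp only [sub_self, norm_zero]
        linarith
  obtain ⟨g, hg, hgn⟩ := Lip.exists_of_bound (o := o) G
    (hG0 o fun k => (h k).map_origin) (by positivity) hbound
  exact ⟨g, hgn, fun k m hk => (hg m).trans (hG k m hk),
    fun m hm => (hg m).trans (hG0 m hm)⟩

/-- On a uniformly discrete space, restricting a Lipschitz function to a bounded set yields a
Lipschitz function. -/
theorem Lip.exists_indicator {θ : ℝ} (hθ : 0 < θ) (hM : ∀ x y : M, x ≠ y → θ ≤ dist x y)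
    (S : Set M) {R : ℝ} (hR : 0 ≤ R) (hS : ∀ m ∈ S, dist m o ≤ R) (f : Lip o Y) :
    ∃ h : Lip o Y, (∀ m ∈ S, h m = f m) ∧ (∀ m ∉ S, h m = 0) ∧ ‖h‖ ≤ 2 * R / θ * ‖f‖ := by
  classical
  have hb : ∀ m, ‖S.indicator f m‖ ≤ R * ‖f‖ := by
    intro m
    by_cases hm : m ∈ S
    · rw [Set.indicator_of_mem hm, mul_comm]
      exact (f.norm_apply_le m).trans (mul_le_mul_of_nonneg_left (hS m hm) (norm_nonneg f))
    · rw [Set.indicator_of_notMem hm, norm_zero]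
      positivity
  obtain ⟨h, hh, hn⟩ := Lip.exists_of_bound (o := o) (S.indicator f)
    (by by_cases ho : o ∈ S <;> simp [ho, f.map_origin])
    (C := 2 * R / θ * ‖f‖) (by positivity) (by
      intro x y
      rcases eq_or_ne x y with rfl | hxy
      · simp
      -- A jump is at most twice the sup bound `R * ‖f‖`, and it takes place over a distance at
      -- least `θ`.
      · have h1 : 2 * (R * ‖f‖) ≤ 2 * R / θ * ‖f‖ * dist x y := by
          have : 2 * (R * ‖f‖) = 2 * R / θ * ‖f‖ * θ := by field_simp
          rw [this]
          exact mul_le_mul_of_nonneg_left (hM x y hxy) (by positivity)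
        linarith [_root_.norm_sub_le (S.indicator f x) (S.indicator f y), hb x, hb y])
  exact ⟨h, fun m hm => by rw [hh, Set.indicator_of_mem hm],
    fun m hm => by rw [hh, Set.indicator_of_notMem hm], hn⟩

/-- Cutting off a Lipschitz function inside a ball around the origin increases the norm by at most
a factor three. -/
theorem Lip.exists_cutoff {r : ℝ} (hr : 0 < r) (f : Lip o Y) :
    ∃ h : Lip o Y, ‖h‖ ≤ 3 * ‖f‖ ∧ (∀ m, f m = 0 → h m = 0) ∧ (∀ m, dist m o ≤ r → h m = 0) ∧
      (∀ m, 2 * r ≤ dist m o → h m = f m) := by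
  let α : M → ℝ := fun m => max 0 (min 1 (dist m o / r - 1))
  have hα0 : ∀ m, 0 ≤ α m := fun m => le_max_left _ _
  have hα1 : ∀ m, α m ≤ 1 := fun m => max_le zero_le_one (min_le_left _ _)
  have hαone : ∀ m, 2 * r ≤ dist m o → α m = 1 := by
    intro m hm
    have : 2 ≤ dist m o / r := by rwa [le_div_iff₀ hr]
    simp only [α]
    rw [min_eq_left (by linarith), max_eq_right zero_le_one]
  have hαzero : ∀ m, dist m o ≤ r → α m = 0 := by
    intro m hm
    have : dist m o / r ≤ 1 := by rwa [div_le_one hr]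
    simp only [α]
    exact max_eq_left ((min_le_right _ _).trans (by linarith))
  have hαlip : ∀ x y, |α x - α y| ≤ dist x y / r := by
    intro x y
    have h1 : |α x - α y| ≤ |min 1 (dist x o / r - 1) - min 1 (dist y o / r - 1)| := by
      have := abs_max_sub_max_le_max 0 (min 1 (dist x o / r - 1)) 0 (min 1 (dist y o / r - 1))
      simpa using this
    have h2 : |min 1 (dist x o / r - 1) - min 1 (dist y o / r - 1)|
        ≤ |(dist x o / r - 1) - (dist y o / r - 1)| := by
      have := abs_min_sub_min_le_max 1 (dist x o / r - 1) 1 (dist y o / r - 1)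
      simpa using this
    have h3 : (dist x o / r - 1) - (dist y o / r - 1) = (dist x o - dist y o) / r := by ring
    rw [h3, abs_div, abs_of_pos hr] at h2
    refine h1.trans (h2.trans ?_)
    gcongr
    exact abs_dist_sub_le x y o
  have key : ∀ x y, dist y o ≤ dist x o →
      ‖α x • f x - α y • f y‖ ≤ 3 * ‖f‖ * dist x y := by
    intro x y hyx
    -- Product rule with the point `y` nearer to the origin in the second term: either `α` is `1` at
    -- both points, or `‖f y‖ ≤ 2 * r * ‖f‖` offsets the Lipschitz constant `1 / r` of `α`.
    have hsplit : α x • f x - α y • f y = α x • (f x - f y) + (α x - α y) • f y := by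
      rw [smul_sub, sub_smul]; abel
    have h1 : ‖α x • (f x - f y)‖ ≤ ‖f‖ * dist x y := by
      rw [norm_smul, Real.norm_of_nonneg (hα0 x)]
      calc α x * ‖f x - f y‖ ≤ 1 * ‖f x - f y‖ :=
            mul_le_mul_of_nonneg_right (hα1 x) (norm_nonneg _)
        _ ≤ ‖f‖ * dist x y := by rw [one_mul]; exact f.norm_sub_le x y
    have h2 : ‖(α x - α y) • f y‖ ≤ 2 * ‖f‖ * dist x y := by
      rcases le_total (2 * r) (dist y o) with hy | hy
      · rw [hαone x (hy.trans hyx), hαone y hy]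
        simp only [sub_self, zero_smul, norm_zero]
        positivity
      · rw [norm_smul, Real.norm_eq_abs]
        calc |α x - α y| * ‖f y‖ ≤ dist x y / r * (‖f‖ * (2 * r)) := by
              gcongr
              · exact hαlip x y
              · exact (f.norm_apply_le y).trans (by gcongr)
          _ = 2 * ‖f‖ * dist x y := by field_simp
    rw [hsplit]
    linarith [norm_add_le (α x • (f x - f y)) ((α x - α y) • f y)]
  obtain ⟨h, hh, hn⟩ := Lip.exists_of_bound (o := o) (fun m => α m • f m)
    (by simp [f.map_origin]) (C := 3 * ‖f‖) (by positivity) (by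
      intro x y
      rcases le_total (dist y o) (dist x o) with hyx | hxy
      · exact key x y hyx
      · rw [norm_sub_rev, dist_comm]
        exact key y x hxy)
  refine ⟨h, hn, fun m hm => ?_, fun m hm => ?_, fun m hm => ?_⟩
  · rw [hh, hm, smul_zero]
  · rw [hh, hαzero m hm, zero_smul]
  · rw [hh, hαone m hm, one_smul]

end LipConstructions

/-! ### Finitely supported functionals and their restrictions. -/

section FreeSum

variable {M : Type*} [MetricSpace M] (o : M) {X : Type*} [NormedAddCommGroup X] [NormedSpace ℝ X]

/-- The functional `∑ₘ δ_{m, c(m)}` associated with a finitely supported `c : M → X`. -/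
noncomputable def freeSum (c : M →₀ X) : StrongDual ℝ (Lip o (StrongDual ℝ X)) :=
  ∑ m ∈ c.support, delta o m (c m)

variable {o}

theorem freeSum_apply (c : M →₀ X) (f : Lip o (StrongDual ℝ X)) :
    freeSum o c f = ∑ m ∈ c.support, f m (c m) := by
  simp [freeSum]

open Classical in
theorem freeSum_filter_apply (c : M →₀ X) (S : Set M) (f : Lip o (StrongDual ℝ X)) :
    freeSum o (c.filter (· ∈ S)) f = ∑ m ∈ c.support, if m ∈ S then f m (c m) else 0 := by
  rw [freeSum_apply, Finsupp.support_filter, Finset.sum_filter]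
  refine Finset.sum_congr rfl fun m _ => ?_
  split_ifs with hm
  · rw [Finsupp.filter_apply_pos _ _ hm]
  · rfl

-- Restriction moves from the functional to the test function, so pointwise nullity passes to
-- restrictions whenever the cut function is Lipschitz.
open Classical in
theorem freeSum_filter_eq (c : M →₀ X) (S : Set M) (f h : Lip o (StrongDual ℝ X))
    (h1 : ∀ m ∈ S, h m = f m) (h0 : ∀ m ∉ S, h m = 0) :
    freeSum o (c.filter (· ∈ S)) f = freeSum o c h := by
  rw [freeSum_filter_apply, freeSum_apply]
  refine Finset.sum_congr rfl fun m _ => ?_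
  split_ifs with hm
  · rw [h1 m hm]
  · rw [h0 m hm]; rfl

-- Only the part of `c` in `S` sees the difference of two functions agreeing on the rest of the
-- support; in the gliding hump that part has small norm.
open Classical in
theorem freeSum_filter_sub (c : M →₀ X) (S : Set M) (f g : Lip o (StrongDual ℝ X))
    (h : ∀ m ∈ c.support, m ∉ S → f m = g m) :
    freeSum o (c.filter (· ∈ S)) (f - g) = freeSum o c f - freeSum o c g := by
  rw [freeSum_filter_apply, freeSum_apply, freeSum_apply, ← Finset.sum_sub_distrib]
  refine Finset.sum_congr rfl fun m hm => ?_
  split_ifs with hS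
  · rfl
  · rw [h m hm hS, sub_self]

theorem exists_freeSum_of_mem_span {u : StrongDual ℝ (Lip o (StrongDual ℝ X))}
    (hu : u ∈ Submodule.span ℝ {φ | ∃ (m : M) (x : X), φ = delta o m x}) :
    ∃ c : M →₀ X, u = freeSum o c := by
  classical
  -- Linearity in `c` is hidden by the sum over the varying support; `T` is the same map in bundled
  -- linear form.
  let T : (M →₀ X) →ₗ[ℝ] Lip o (StrongDual ℝ X) →ₗ[ℝ] ℝ :=
    Finsupp.lsum ℝ fun m =>
      { toFun := fun x => (delta o m x).toLinearMap
        map_add' := fun x y => by ext f; exact map_add (f m) x y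
        map_smul' := fun r x => by ext f; exact map_smul (f m) r x }
  have hT : ∀ c f, T c f = freeSum o c f := by
    intro c f
    simp [T, freeSum, Finsupp.sum, Finsupp.lsum_apply]
  suffices h : ∃ c, ∀ f, u f = T c f by
    obtain ⟨c, hc⟩ := h
    exact ⟨c, ContinuousLinearMap.ext fun f => (hc f).trans (hT c f)⟩
  induction hu using Submodule.span_induction with
  | mem u hu =>
    obtain ⟨m, x, rfl⟩ := hu
    exact ⟨Finsupp.single m x, fun f => by simp [T]⟩
  | zero => exact ⟨0, fun f => by simp⟩
  | add u v _ _ hu hv =>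
    obtain ⟨c, hc⟩ := hu
    obtain ⟨d, hd⟩ := hv
    exact ⟨c + d, fun f => by simp [hc, hd]⟩
  | smul r u _ hu =>
    obtain ⟨c, hc⟩ := hu
    exact ⟨r • c, fun f => by simp [hc]⟩

theorem norm_freeSum_le (c : M →₀ X) (A : Finset M) (hA : c.support ⊆ A) :
    ‖freeSum o c‖ ≤ ∑ m ∈ A, dist m o * ‖c m‖ := by
  have h : ∀ m, ‖delta o m (c m)‖ ≤ dist m o * ‖c m‖ := fun m =>
    LinearMap.mkContinuous_norm_le _ (by positivity) _
  calc ‖freeSum o c‖ ≤ ∑ m ∈ c.support, dist m o * ‖c m‖ :=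
        norm_sum_le_of_le _ fun m _ => h m
    _ ≤ _ := Finset.sum_le_sum_of_subset_of_nonneg hA fun _ _ _ => by positivity

end FreeSum


/-! ### The gliding hump argument and its two applications. -/

section GlidingHump

variable {M : Type*} [MetricSpace M] {o : M} {X : Type*} [NormedAddCommGroup X] [NormedSpace ℝ X]

open Classical in
/-- Gliding hump: a pointwise null sequence of finitely supported functionals whose restrictions to
each member of an exhaustion tend to zero in norm is itself norm null, provided that there are
uniformly bounded cutoffs adapted to the exhaustion. -/
theorem tendsto_norm_freeSum_of_exhaustion (c : ℕ → M →₀ X) {S : ℕ → Set M} (hS : Monotone S)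
    (hw : ∀ f, Tendsto (fun n => freeSum o (c n) f) atTop (𝓝 0))
    (hsmall : ∀ j, Tendsto (fun n => ‖freeSum o ((c n).filter (· ∈ S j))‖) atTop (𝓝 0))
    (hsupp : ∀ n, ∃ j, ∀ m ∈ (c n).support, m ∈ S j) {C : ℝ} (hC : 0 ≤ C)
    (hcut : ∀ (a b : ℕ) (f : Lip o (StrongDual ℝ X)), ‖f‖ ≤ 1 →
      ∃ h : Lip o (StrongDual ℝ X), ‖h‖ ≤ C ∧ (∀ m ∈ S (a + 1), h m = 0) ∧
        (∀ m ∈ S b, m ∉ S (a + 2) → h m = f m) ∧ ∀ m ∉ S (b + 1), h m = 0) :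
    Tendsto (fun n => ‖freeSum o (c n)‖) atTop (𝓝 0) := by
  by_contra hnot
  rw [Metric.tendsto_atTop] at hnot
  push Not at hnot
  obtain ⟨ε, hε, hfreq⟩ := hnot
  simp only [dist_zero_right, norm_norm] at hfreq
  -- Below, `‖f k - g‖ ≤ 1 + 2 * C`, so a restriction of norm below `η` contributes at most `ε / 4`.
  set η : ℝ := ε / (4 * (1 + 2 * C)) with hη
  have hηpos : 0 < η := by positivity
  have hstep : ∀ k j : ℕ, ∃ n, k ≤ n ∧ ε ≤ ‖freeSum o (c n)‖ ∧
      ‖freeSum o ((c n).filter (· ∈ S (j + 2)))‖ < η := by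
    intro k j
    obtain ⟨N, hN⟩ := eventually_atTop.1 ((hsmall (j + 2)).eventually_lt_const hηpos)
    obtain ⟨n, hn, hn'⟩ := hfreq (max k N)
    exact ⟨n, (le_max_left _ _).trans hn, hn', hN n ((le_max_right _ _).trans hn)⟩
  choose ν hνle hνbig hνsmall using hstep
  choose J hJ using hsupp
  -- The set `S (j k)` contains the supports of all functionals chosen before stage `k`; the next
  -- one is chosen nearly null on `S (j k + 2)`.
  let j : ℕ → ℕ := fun k => Nat.rec 0 (fun k i => max i (J (ν k i))) k
  let n : ℕ → ℕ := fun k => ν k (j k)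
  have hjsucc : ∀ k, j (k + 1) = max (j k) (J (n k)) := fun _ => rfl
  have hj : Monotone j := monotone_nat_of_le_succ fun k => by
    rw [hjsucc]; exact le_max_left _ _
  have hf : ∀ k, ∃ f : Lip o (StrongDual ℝ X), ‖f‖ ≤ 1 ∧ ε / 2 < ‖freeSum o (c (n k)) f‖ := by
    intro k
    obtain ⟨f, hf1, hf2⟩ := (freeSum o (c (n k))).exists_lt_apply_of_lt_opNorm
      (show ε / 2 < ‖freeSum o (c (n k))‖ by linarith [hνbig k (j k)])
    exact ⟨f, hf1.le, hf2⟩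
  choose f hf1 hf2 using hf
  choose h hhn hh0 hhf hhout using fun k => hcut (j k) (j (k + 1)) (f k) (hf1 k)
  -- The hump `h k` lives in `S (j (k + 1) + 1)`, and every later hump vanishes there: the cutoffs
  -- start one index late to leave room for the outer transition of the previous one.
  have hlt : ∀ k l m, k < l → h k m ≠ 0 → h l m = 0 := by
    intro k l m hkl hk
    refine hh0 l m (hS (Nat.succ_le_succ (hj hkl)) ?_)
    by_contra hm
    exact hk (hhout k m hm)
  have hdisj : ∀ k l m, h k m ≠ 0 → h l m ≠ 0 → k = l := by
    intro k l m hk hl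
    rcases lt_trichotomy k l with hkl | hkl | hkl
    · exact absurd (hlt k l m hkl hk) hl
    · exact hkl
    · exact absurd (hlt l k m hkl hl) hk
  obtain ⟨g, hgn, hg, hg0⟩ := Lip.exists_glue h hC hhn hdisj
  -- Gluing prescribes `g` only where some hump is nonzero. At zeros of `f k` in its layer, all
  -- other humps must be excluded as well to get `g = f k` there.
  have hzero : ∀ k m, m ∈ S (j (k + 1)) → m ∉ S (j k + 2) → f k m = 0 →
      ∀ l, h l m = 0 := by
    intro k m hm hm' hfm l
    rcases lt_trichotomy k l with hkl | hkl | hkl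
    · exact hh0 l m (hS ((hj hkl).trans (Nat.le_succ _)) hm)
    · subst hkl
      rw [hhf k m hm hm', hfm]
    · refine hhout l m fun hmem => hm' (hS ?_ hmem)
      have : j (l + 1) ≤ j k := hj hkl
      omega
  have hfg : ∀ k, ∀ m ∈ (c (n k)).support, m ∉ S (j k + 2) → f k m = g m := by
    intro k m hm hm'
    have hmem : m ∈ S (j (k + 1)) :=
      hS (by rw [hjsucc]; exact le_max_right _ _) (hJ (n k) m hm)
    by_cases hfm : f k m = 0
    · rw [hfm, hg0 m (hzero k m hmem hm' hfm)]
    · have := hhf k m hmem hm'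
      rw [hg k m (by rwa [this]), this]
  have hbig : ∀ k, ε / 4 ≤ ‖freeSum o (c (n k)) g‖ := by
    intro k
    have hdiff : ‖freeSum o (c (n k)) (f k) - freeSum o (c (n k)) g‖ ≤ ε / 4 := by
      rw [← freeSum_filter_sub _ _ _ _ (hfg k)]
      calc _ ≤ ‖freeSum o ((c (n k)).filter (· ∈ S (j k + 2)))‖ * ‖f k - g‖ :=
            ContinuousLinearMap.le_opNorm _ _
        _ ≤ η * (1 + 2 * C) := by
            refine mul_le_mul (hνsmall k (j k)).le ?_ (norm_nonneg _) hηpos.le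
            exact (_root_.norm_sub_le _ _).trans (add_le_add (hf1 k) hgn)
        _ = ε / 4 := by rw [hη]; field_simp
    have := norm_sub_norm_le (freeSum o (c (n k)) (f k)) (freeSum o (c (n k)) g)
    linarith [hf2 k]
  have hn : Tendsto n atTop atTop :=
    tendsto_atTop_mono (fun k => hνle k (j k)) tendsto_id
  have hlim := ((hw g).comp hn).norm
  rw [norm_zero] at hlim
  have := ge_of_tendsto' hlim hbig
  linarith

-- The weight `dist m o` bounds the norm of the evaluation at `m`; at the origin it is zero, so
-- nothing is required of `c n o`.
open Classical in
theorem tendsto_norm_freeSum_filter_finite (c : ℕ → M →₀ X)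
    (hpt : ∀ m, Tendsto (fun n => dist m o * ‖c n m‖) atTop (𝓝 0)) {S : Set M} (hS : S.Finite) :
    Tendsto (fun n => ‖freeSum o ((c n).filter (· ∈ S))‖) atTop (𝓝 0) := by
  refine squeeze_zero (fun _ => norm_nonneg _) (fun n => ?_)
    (g := fun n => ∑ m ∈ hS.toFinset, dist m o * ‖c n m‖) ?_
  · refine (norm_freeSum_le _ hS.toFinset fun m hm => ?_).trans
      (Finset.sum_le_sum fun m hm => ?_)
    · rw [Finsupp.support_filter, Finset.mem_filter] at hm
      exact hS.mem_toFinset.2 hm.2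
    · rw [Finsupp.filter_apply_pos _ _ (hS.mem_toFinset.1 hm)]
  · simpa using tendsto_finsetSum hS.toFinset fun m _ => hpt m

open Classical in
/-- In a uniformly discrete space, weak nullity together with coordinatewise nullity forces
norm nullity of the restrictions to bounded sets. -/
theorem tendsto_norm_freeSum_filter_bounded {θ : ℝ} (hθ : 0 < θ)
    (hM : ∀ x y : M, x ≠ y → θ ≤ dist x y) (c : ℕ → M →₀ X)
    (hw : ∀ f, Tendsto (fun n => freeSum o (c n) f) atTop (𝓝 0))
    (hpt : ∀ m, Tendsto (fun n => dist m o * ‖c n m‖) atTop (𝓝 0))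
    (B : Set M) {R : ℝ} (hR : 0 ≤ R) (hB : ∀ m ∈ B, dist m o ≤ R) :
    Tendsto (fun n => ‖freeSum o ((c n).filter (· ∈ B))‖) atTop (𝓝 0) := by
  -- Bounded sets may be infinite, but only the countably many support points in `B` matter, and
  -- finitely many of them occur up to index `j`.
  let S : ℕ → Set M := fun j => {m | m ∈ B ∧ ∃ i ≤ j, m ∈ (c i).support}
  have hSmono : Monotone S := fun a b hab m ⟨hm, i, hi, hmi⟩ => ⟨hm, i, hi.trans hab, hmi⟩
  have hSfin : ∀ j, (S j).Finite := fun j =>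
    ((Set.finite_Iic j).biUnion fun i _ => (c i).support.finite_toSet).subset
      fun m ⟨_, i, hi, hmi⟩ => Set.mem_biUnion (Set.mem_Iic.2 hi) hmi
  have hSR : ∀ j, ∀ m ∈ S j, dist m o ≤ R := fun j m hm => hB m hm.1
  refine tendsto_norm_freeSum_of_exhaustion _ hSmono ?_ ?_ ?_
    (C := 2 * R / θ) (by positivity) ?_
  · intro f
    obtain ⟨h, h1, h0, -⟩ := f.exists_indicator hθ hM B hR hB
    simpa only [freeSum_filter_eq _ B f h h1 h0] using hw h
  · intro j
    refine tendsto_norm_freeSum_filter_finite _ (fun m => ?_) (hSfin j)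
    refine squeeze_zero (fun _ => by positivity) (fun n => ?_) (hpt m)
    refine mul_le_mul_of_nonneg_left ?_ dist_nonneg
    rw [Finsupp.filter_apply]
    split_ifs
    · exact le_rfl
    · simp
  · intro n
    refine ⟨n, fun m hm => ?_⟩
    rw [Finsupp.support_filter, Finset.mem_filter] at hm
    exact ⟨hm.2, n, le_rfl, hm.1⟩
  · intro a b f hf
    obtain ⟨h, h1, h0, hn⟩ := f.exists_indicator hθ hM (S b \ S (a + 1)) hR
      fun m hm => hSR b m hm.1
    refine ⟨h, hn.trans (mul_le_of_le_one_right (by positivity) hf),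
      fun m hm => h0 m fun hm' => hm'.2 hm,
      fun m hm hm' => h1 m ⟨hm, fun hm'' => hm' (hSmono (Nat.le_succ _) hm'')⟩,
      fun m hm => h0 m fun hm' => hm (hSmono (Nat.le_succ _) hm'.1)⟩

theorem tendsto_norm_freeSum {θ : ℝ} (hθ : 0 < θ)
    (hM : ∀ x y : M, x ≠ y → θ ≤ dist x y) (c : ℕ → M →₀ X)
    (hw : ∀ f, Tendsto (fun n => freeSum o (c n) f) atTop (𝓝 0))
    (hpt : ∀ m, Tendsto (fun n => dist m o * ‖c n m‖) atTop (𝓝 0)) :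
    Tendsto (fun n => ‖freeSum o (c n)‖) atTop (𝓝 0) := by
  have hpow : ∀ k : ℕ, (0 : ℝ) < 2 ^ k := fun k => by positivity
  refine tendsto_norm_freeSum_of_exhaustion c (S := fun j => {m | dist m o ≤ 2 ^ j})
    (fun a b hab m (hm : dist m o ≤ 2 ^ a) =>
      hm.trans (pow_le_pow_right₀ one_le_two hab)) hw
    (fun j => tendsto_norm_freeSum_filter_bounded hθ hM c hw hpt _ (hpow j).le fun m hm => hm)
    ?_ (C := 12) (by norm_num) ?_
  · intro n
    obtain ⟨r, hr⟩ := ((c n).support.image (dist · o)).bddAbove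
    obtain ⟨j, hj⟩ := pow_unbounded_of_one_lt r (one_lt_two (α := ℝ))
    exact ⟨j, fun m hm => (hr (by simpa using ⟨m, by simpa using hm, rfl⟩)).trans hj.le⟩
  · intro a b f hf
    -- The layer cutoff is `h - h'`: `h` removes the inner ball, and `h'` is the outer tail of `h`.
    -- Norms are at most `3` and `9`, giving `12`; the doubling of radii in each transition is one
    -- step of the exhaustion.
    obtain ⟨h, hn, hz, hin, hout⟩ := f.exists_cutoff (hpow (a + 1))
    obtain ⟨h', hn', hz', hin', hout'⟩ := h.exists_cutoff (hpow b)
    simp only [Set.mem_ofPred_eq, not_le]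
    refine ⟨h - h', ?_, fun m hm => ?_, fun m hm hm' => ?_, fun m hm => ?_⟩
    · linarith [_root_.norm_sub_le h h']
    · rw [Lip.sub_apply, hin m hm, hz' m (hin m hm), sub_zero]
    · rw [Lip.sub_apply, hin' m hm, hout m (by rw [pow_succ] at hm'; linarith), sub_zero]
    · rw [Lip.sub_apply, hout' m (by rw [pow_succ] at hm; linarith), sub_self]

end GlidingHump

/-! ### Weak nullity and the coordinates. -/

section Schur

theorem tendsto_toWeakSpace_zero_iff {E : Type*} [NormedAddCommGroup E] [NormedSpace ℝ E]
    (u : ℕ → E) : Tendsto (fun n => toWeakSpace ℝ E (u n)) atTop (𝓝 0) ↔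
      ∀ l : StrongDual ℝ E, Tendsto (fun n => l (u n)) atTop (𝓝 0) := by
  have hind : Topology.IsInducing fun (x : WeakSpace ℝ E) (l : StrongDual ℝ E) =>
      (topDualPairing ℝ E).flip x l := ⟨rfl⟩
  rw [hind.tendsto_nhds_iff, tendsto_pi_nhds]
  refine forall_congr' fun l => ?_
  have h0 : (topDualPairing ℝ E).flip (0 : WeakSpace ℝ E) l = 0 := map_zero l
  rw [h0]
  rfl

variable {M : Type*} [MetricSpace M] {o : M} {X : Type*} [NormedAddCommGroup X] [NormedSpace ℝ X]

/-- For a Schur space `X`, the coordinates of a weakly null sequence of finitely supported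
functionals are norm null. -/
theorem tendsto_coordinate {θ : ℝ} (hθ : 0 < θ) (hM : ∀ x y : M, x ≠ y → θ ≤ dist x y)
    (hX : HasSchurProperty X) (c : ℕ → M →₀ X)
    (hw : ∀ f : Lip o (StrongDual ℝ X), Tendsto (fun n => freeSum o (c n) f) atTop (𝓝 0))
    {m : M} (hm : m ≠ o) : Tendsto (fun n => c n m) atTop (𝓝 0) := by
  classical
  refine hX _ ((tendsto_toWeakSpace_zero_iff _).2 fun l => ?_)
  -- The function equal to `l` at `m` and zero elsewhere is Lipschitz by uniform discreteness,
  -- vanishes at `o` since `m ≠ o`, and reads off `l (c n m)`.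
  obtain ⟨f, hf, -⟩ := Lip.exists_of_bound (o := o) (Pi.single m l : M → StrongDual ℝ X)
    (by simp [hm.symm]) (C := 2 * ‖l‖ / θ) (by positivity) (by
      intro x y
      rcases eq_or_ne x y with rfl | hxy
      · simp
      · have hb : ∀ z, ‖(Pi.single m l : M → StrongDual ℝ X) z‖ ≤ ‖l‖ := fun z => by
          by_cases hz : z = m
          · subst hz; simp
          · simp [hz]
        have h1 : 2 * ‖l‖ ≤ 2 * ‖l‖ / θ * dist x y := by
          rw [div_mul_eq_mul_div, le_div_iff₀ hθ]
          exact mul_le_mul_of_nonneg_left (hM x y hxy) (by positivity)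
        linarith [_root_.norm_sub_le ((Pi.single m l : M → StrongDual ℝ X) x)
          ((Pi.single m l : M → StrongDual ℝ X) y), hb x, hb y])
  refine (hw f).congr fun n => ?_
  rw [freeSum_apply, Finset.sum_eq_single m]
  · simp [hf]
  · intro z _ hz
    simp [hf, hz]
  · intro hmn
    rw [Finsupp.notMem_support_iff.1 hmn, map_zero]

end Schur

end VectorLipschitz

theorem proposition3p4 {M : Type*} [MetricSpace M] (o : M)
    (hM : 0 < (Set.univ : Set M).einfsep)
    {X : Type*} [NormedAddCommGroup X] [NormedSpace ℝ X] [CompleteSpace X]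
    (hX : VectorLipschitz.HasSchurProperty X) :
    VectorLipschitz.HasSchurProperty (VectorLipschitz.lipschitzFree o X) := by
  open VectorLipschitz in
  obtain ⟨θ, hθ, hdist⟩ : ∃ θ : ℝ, 0 < θ ∧ ∀ x y : M, x ≠ y → θ ≤ dist x y := by
    obtain ⟨C, hC, h⟩ := Set.einfsep_pos.1 hM
    -- The bound `C` may be `⊤`, whose `toReal` is `0`; the minimum with `1` keeps the constant
    -- positive.
    refine ⟨(min C 1).toReal, ENNReal.toReal_pos (by simp [hC.ne']) (by simp), fun x y hxy => ?_⟩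
    rw [dist_edist]
    exact ENNReal.toReal_mono (edist_ne_top x y)
      ((min_le_left _ _).trans (h x (Set.mem_univ x) y (Set.mem_univ y) hxy))
  intro u hu
  rw [tendsto_toWeakSpace_zero_iff] at hu
  have happrox : ∀ n, ∃ c : M →₀ X,
      ‖(u n : StrongDual ℝ (Lip o (StrongDual ℝ X))) - freeSum o c‖ < 1 / ((n : ℝ) + 1) := by
    intro n
    obtain ⟨v, hv, hvd⟩ := Metric.mem_closure_iff.1 (u n).2 (1 / ((n : ℝ) + 1)) (by positivity)
    obtain ⟨c, rfl⟩ := exists_freeSum_of_mem_span hv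
    exact ⟨c, by rwa [← dist_eq_norm]⟩
  choose c hc using happrox
  have hdiff : Tendsto (fun n => (u n : StrongDual ℝ (Lip o (StrongDual ℝ X))) - freeSum o (c n))
      atTop (𝓝 0) :=
    squeeze_zero_norm (fun n => (hc n).le) tendsto_one_div_add_atTop_nhds_zero_nat
  have hw : ∀ f, Tendsto (fun n => freeSum o (c n) f) atTop (𝓝 0) := by
    intro f
    have h1 : Tendsto (fun n => (u n : StrongDual ℝ (Lip o (StrongDual ℝ X))) f) atTop (𝓝 0) :=
      -- Of weak nullity, only evaluations at Lipschitz functions are used.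
      hu ((ContinuousLinearMap.apply ℝ ℝ f).comp (lipschitzFree o X).subtypeL)
    have h2 := ((ContinuousLinearMap.apply ℝ ℝ f).continuous.tendsto _).comp hdiff
    simpa [Function.comp_def] using h1.sub h2
  have hpt : ∀ m, Tendsto (fun n => dist m o * ‖c n m‖) atTop (𝓝 0) := by
    intro m
    rcases eq_or_ne m o with rfl | hm
    · simp
    · simpa using (tendsto_coordinate hθ hdist hX c hw hm).norm.const_mul (dist m o)
  have hc0 := tendsto_zero_iff_norm_tendsto_zero.2 (tendsto_norm_freeSum hθ hdist c hw hpt)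
  rw [tendsto_subtype_rng]
  simpa using hdiff.add hc0
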